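/- Logarithms are to base $2$. Let $1\le d\le n$ and let $\sigma^X=(\sigma_1,\dots,\sigma_n)$ be any permutation of $\{1,\dots,n\}$, held by a transmitter. A receiver holds $\sigma^Y$, obtained from $\sigma^X$ by deleting the symbols at $d$ positions; all $\binom nd$ sets of positions are equally likely. Both sides know $n$ and $d$. *Limited-feedback protocol.* A word of length $m$ has its central symbol at position $\lceil m/2\rceil$; the symbols before and after it form its left and right halves. The inversion vector of a word $w_1\dots w_l$ is the binary vector $x\in\{0,1\}^{l-1}$ with $x_i=1$ iff $w_i>w_{i+1}$, its VT-syndrome is $\sum_i i\,x_i \bmod l$, and the checksum of the word is $\sum_i w_i$. The two sides keep a list of unsynchronized substrings of $\sigma^X$ and the corresponding noisy substrings of $\sigma^Y$, starting with $(\sigma^X,\sigma^Y)$; the receiver knows the number $k$ of deletions in each from the difference in lengths. - If $k=0$, nothing is sent. - If $k=1$, the transmitter sends the VT-syndrome of the inversion vector and the checksum of the substring of $\sigma^X$. The receiver finds the missing symbol as the difference of the checksums, and inserts it at a position that produces the received syndrome. - If $k\ge 2$, the transmitter sends the central symbol of the substring. If the receiver finds no match for it in his noisy substring, both sides continue with the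 substring of $\sigma^X$ from which the central symbol has been removed (having $k-1$ deletions), and the receiver finally reinserts that symbol at the central position. If the receiver finds a match, the two noisy parts on either side of the matched symbol are paired with the two halves, and each half is treated as a substring with its own number of deletions. After each central symbol the receiver sends one feedback message, telling whether a match was found and, for the resulting substring(s), whether the number of deletions is $0$, $1$ or at least $2$; there are eight possible messages. *Cost.* A central symbol costs $\log n$ bits, the VT-syndrome of a substring of length $l$ costs $\log l$ bits, a checksum with value $t$ costs $\log t$ bits, and a feedback message costs $\log 8=3$ bits. Let $N_{T\to R}(d)$ and $N_{R\to T}(d)$ be the total numbers of bits sent forward and on the feedback link. **Theorem.** For every deletion pattern the receiver outputs exactly $\sigma^X$. Moreover, for every fixed $\sigma^X$, with expectations over the uniformly random deletion pattern, $$\mathbb E[N_{T\to R}(d)]\le(5d-2)\log n-2d\log d-d\log 2\qquad(2\le d\le n),$$ $$\mathbb E[N_{R\to T}(d)]\le 6(d-1)\qquad(1\le d\le n),$$ while for $d=1$, when no central symbol is needed, $\mathbb E[N_{T\to R}(1)]=3\log n-\log 2+\log\left(1+\tfrac1n\right)$. -/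

import Mathlib

open scoped BigOperators

namespace RankSync

/-! # Permutation words, inversion vectors, syndromes and checksums -/

/-- The one-line word `(σ₁, …, σₙ)` of a permutation, with symbols in `{1, …, n}`. -/
def word {n : ℕ} (σ : Equiv.Perm (Fin n)) : List ℕ :=
  (List.finRange n).map fun i => (σ i : ℕ) + 1

/-- The partial permutation obtained from `σ` by deleting the symbols at the positions in `S`. -/
def deletedWord {n : ℕ} (σ : Equiv.Perm (Fin n)) (S : Finset (Fin n)) : List ℕ :=
  ((List.finRange n).filter fun i => i ∉ S).map fun i => (σ i : ℕ) + 1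

/-- The inversion vector of a word `w`: the binary vector of length `|w| - 1` whose `i`-th entry
is `1` exactly when the `i`-th symbol exceeds the next one. -/
def inversionVector (w : List ℕ) : List ℕ :=
  List.zipWith (fun a b => if b < a then 1 else 0) w w.tail

/-- The Varshamov-Tenengolts syndrome `∑ i · xᵢ mod (N + 1)` of a binary vector of length `N`. -/
def vtSyndrome (x : List ℕ) : ℕ :=
  (∑ i ∈ Finset.range x.length, (i + 1) * x.getD i 0) % (x.length + 1)

/-- The checksum of a word: the sum of its symbols. -/
def checksum (w : List ℕ) : ℕ := w.sum

/-! # Substrings and their halves -/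

/-- The index (counted from `0`) of the central symbol of a word of length `m`,
i.e. the `⌈m / 2⌉`-th symbol. It is also the length of the left half. -/
def centre (m : ℕ) : ℕ := (m - 1) / 2

/-- The central symbol. -/
def centralSymbol (x : List ℕ) : ℕ := x.getD (centre x.length) 0

/-- The part of `x` strictly to the left of the central symbol. -/
def leftHalf (x : List ℕ) : List ℕ := x.take (centre x.length)

/-- The part of `x` strictly to the right of the central symbol. -/
def rightHalf (x : List ℕ) : List ℕ := x.drop (centre x.length + 1)

/-- The word `x` with its central symbol removed. -/
def removeCentre (x : List ℕ) : List ℕ := x.eraseIdx (centre x.length)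

/-! # Feedback messages -/

/-- The messages that the receiver may send after it was sent the central symbol of a substring
containing at least two deletions. The first two: there is no match for the central symbol, and one
(resp. at least two) further deletions remain. The other six: the central symbol was matched; the
two parts of the name describe the left and the right half, which contain no deletion (`clean`,
nothing is requested), exactly one deletion (`single`, the syndrome and checksum are requested) or
at least two (`many`, the half is put on the list of substrings to be split). -/
inductive Verdict
  | missingSingle | missingMany
  | cleanMany | manyClean | singleSingle | singleMany | manySingle | manyMany
  deriving DecidableEq

instance : Fintype Verdict where
  elems := {.missingSingle, .missingMany, .cleanMany, .manyClean, .singleSingle, .singleMany,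
    .manySingle, .manyMany}
  complete v := by cases v <;> decide

/-- There are eight feedback messages, so that each of them takes three bits. -/
theorem card_verdict : Fintype.card Verdict = 8 := rfl

/-- The message for a matched central symbol with `dl` deletions in the left half and `dr` in the
right half, where `dl + dr ≥ 2`. -/
def matchedVerdict (dl dr : ℕ) : Verdict :=
  if dl = 0 then .cleanMany
  else if dr = 0 then .manyClean
  else if dl = 1 then (if dr = 1 then .singleSingle else .singleMany)
  else if dr = 1 then .manySingle
  else .manyMany

/-- The message for an unmatched central symbol when `k` further deletions remain, `k ≥ 1`. -/
def missingVerdict (k : ℕ) : Verdict :=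
  if k = 1 then .missingSingle else .missingMany

/-! # The transmitter -/

/-- The pending actions of the transmitter, each concerning a substring `x` of its permutation. -/
inductive Task
  /-- send the central symbol of `x` -/
  | sendCentre (x : List ℕ)
  /-- the central symbol of `x` was sent; wait for the feedback message -/
  | awaitVerdict (x : List ℕ)
  /-- send the syndrome of the inversion vector of `x` and the checksum of `x` -/
  | sendCode (x : List ℕ)

/-- How the transmitter replaces the substring `x` when it gets the feedback message on `x`. -/
def respond (x : List ℕ) : Verdict → List Task
  | .missingSingle => [.sendCode (removeCentre x)]
  | .missingMany => [.sendCentre (removeCentre x)]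
  | .cleanMany => [.sendCentre (rightHalf x)]
  | .manyClean => [.sendCentre (leftHalf x)]
  | .singleSingle => [.sendCode (leftHalf x), .sendCode (rightHalf x)]
  | .singleMany => [.sendCode (leftHalf x), .sendCentre (rightHalf x)]
  | .manySingle => [.sendCentre (leftHalf x), .sendCode (rightHalf x)]
  | .manyMany => [.sendCentre (leftHalf x), .sendCentre (rightHalf x)]

/-- The initial action of the transmitter, which knows the number `d` of deletions and the
permutation `x`. -/
def initialTasks (d : ℕ) (x : List ℕ) : List Task :=
  if d = 0 then [] else if d = 1 then [.sendCode x] else [.sendCentre x]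

/-! # The receiver -/

/-- Programs for the receiver: it can wait for a symbol, send a feedback message, wait for a
syndrome and a checksum, and stop with an output. The program is a function only of what
the receiver has got so far. -/
inductive Receiver
  | done (out : List ℕ)
  | getSymbol (k : ℕ → Receiver)
  | reply (v : Verdict) (k : Receiver)
  | getCode (k : ℕ → ℕ → Receiver)

/-- Correction of a single deletion in `y`: the checksum `t` of the original word of length `m`
determines the missing symbol `t - ∑ y`, which is inserted at the (first) position for which the
inversion vector has the syndrome `s`. -/
def decodeSingle (m : ℕ) (y : List ℕ) (s t : ℕ) : List ℕ :=
  let b := t - checksum y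
  let insertions := (List.range m).map fun i => y.insertIdx i b
  (insertions.find? fun w => vtSyndrome (inversionVector w) == s).getD y

/-- The receiver's program for restoring a substring of known length `m` from its noisy version `y`
(with `m - |y|` deletions); `next` is the program that continues with the restored substring. -/
def restore (m : ℕ) (y : List ℕ) (next : List ℕ → Receiver) : Receiver :=
  if _h₀ : m ≤ y.length then next y
  else if _h₁ : m = y.length + 1 then
    .getCode fun s t => next (decodeSingle m y s t)
  else
    .getSymbol fun c =>
      if c ∈ y then
        let p := y.idxOf c
        let yl := y.take p
        let yr := y.drop (p + 1)
        let ml := centre m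
        let mr := m - 1 - ml
        .reply (matchedVerdict (ml - yl.length) (mr - yr.length))
          (restore ml yl fun l => restore mr yr fun r => next (l ++ c :: r))
      else
        .reply (missingVerdict (m - 1 - y.length))
          (restore (m - 1) y fun z => next (z.insertIdx (centre m) c))
termination_by m
decreasing_by
  all_goals
    try unfold centre
    omega

/-! # Running the protocol -/

/-- The messages exchanged. A syndrome is recorded together with its modulus, which both sides
know (the receiver is handed only the value). -/
inductive Event
  | symbol (c : ℕ)
  | syndrome (modulus value : ℕ)
  | checksum (t : ℕ)
  | feedback (v : Verdict)

/-- The joint run of a receiver's program and a transmitter with the given list of pending actions: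
the receiver's output (`none` if the two parties get out of step) and the messages exchanged. -/
def run : Receiver → List Task → Option (List ℕ) × List Event
  | .done out, [] => (some out, [])
  | .getSymbol k, .sendCentre x :: rest =>
      let c := centralSymbol x
      let o := run (k c) (.awaitVerdict x :: rest)
      (o.1, .symbol c :: o.2)
  | .reply v k, .awaitVerdict x :: rest =>
      let o := run k (respond x v ++ rest)
      (o.1, .feedback v :: o.2)
  | .getCode k, .sendCode x :: rest =>
      let s := vtSyndrome (inversionVector x)
      let t := checksum x
      let o := run (k s t) rest
      (o.1, .syndrome ((inversionVector x).length + 1) s :: .checksum t :: o.2)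
  | _, _ => (none, [])

/-- The limited-feedback protocol for a transmitter holding `x`, a permutation of `{1, …, n}`, and a
receiver holding `y`, obtained from `x` by `d` deletions; both know `n` and `d`. -/
def limitedFeedback (n d : ℕ) (x y : List ℕ) : Option (List ℕ) × List Event :=
  run (restore n y .done) (initialTasks d x)

/-! # Communication cost, in bits (binary logarithms) -/

/-- Bits on the forward link: `log n` for a symbol of `{1, …, n}`, `log q` for a residue modulo `q`,
and `log t` for a checksum `t`. -/
noncomputable def forwardCost (n : ℕ) : Event → ℝ
  | .symbol _ => Real.logb 2 n
  | .syndrome q _ => Real.logb 2 q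
  | .checksum t => Real.logb 2 t
  | .feedback _ => 0

/-- Bits on the feedback link: the logarithm of the number of possible feedback messages. -/
noncomputable def feedbackCost : Event → ℝ
  | .feedback _ => Real.logb 2 (Fintype.card Verdict)
  | _ => 0

/-- The number of bits sent from the transmitter to the receiver when the symbols of `σ` at
the positions in `S` are deleted. -/
noncomputable def forwardBits {n : ℕ} (σ : Equiv.Perm (Fin n)) (S : Finset (Fin n)) : ℝ :=
  ((limitedFeedback n S.card (word σ) (deletedWord σ S)).2.map (forwardCost n)).sum

/-- The number of bits sent from the receiver to the transmitter when the symbols of `σ` at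
the positions in `S` are deleted. -/
noncomputable def feedbackBits {n : ℕ} (σ : Equiv.Perm (Fin n)) (S : Finset (Fin n)) : ℝ :=
  ((limitedFeedback n S.card (word σ) (deletedWord σ S)).2.map feedbackCost).sum

/-- The set of the `n.choose d` patterns of `d` deletions. -/
def patterns (n d : ℕ) : Finset (Finset (Fin n)) := Finset.powersetCard d Finset.univ

end RankSync

namespace RankSync

/-! # Single-deletion correction -/

/-! Correctness. The symbols are distinct, so a central symbol occurs in the noisy substring exactly
when it was not deleted, and a match splits the noisy substring at the right place. The
single-deletion step remains. Inserting a symbol inserts one bit into the inversion vector, and the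
syndrome determines the resulting binary vector (`insert_eq_of_vtSyndrome_eq`). The vector in turn
fixes the place of the symbol: sliding `b` across a nonempty block `M` without changing the vector
would make all comparisons along `b M b` agree, which is impossible if `b` is not in `M`.
`run_restore` lifts this to the whole protocol and identifies the messages with the recursively
defined `transcript`.

Expected symbols. Count each central symbol once, and each unmatched one a second time. By induction
on the word the mean of this count under `k ≥ 1` deletions is at most `2 (k - 1)`
(`sum_symbolCost_sub_nonpos`). An unmatched centre pays 2 and uses up one deletion, so the bound is
preserved. A matched centre pays 1 and splits `k = i + j`; the bounds for the halves leave an excess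
`-1 + 2 [i = 0] + 2 [j = 0]`. Its mean is nonpositive because a half is spared with total
probability at most `1/2` (`choose_mul_le`).

Syndromes and checksums. For every pattern with `d ≥ 2` and `m` unmatched centres, the `d - m` coded
pieces are disjoint in symbols and avoid every central symbol sent. Concavity of the logarithm
bounds their cost by `m log n + 3 d log n - 2 d log d - d log 2` (`codeCost_le`). The term `m log n`
is the reason for counting unmatched centres twice: the forward cost is at most that count times
`log n` plus a constant, and its mean yields `2 (d - 1) + 3 d = 5 d - 2`. Feedback costs 3 bits per
central symbol, hence at most `6 (d - 1)` on average. -/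

/-- The sum `∑ (k + i) · xᵢ` over a word, with the weights starting at `k`. -/
def weightedSum : ℕ → List ℕ → ℕ
  | _, [] => 0
  | k, a :: l => k * a + weightedSum (k + 1) l

theorem weightedSum_append (k : ℕ) (l l' : List ℕ) :
    weightedSum k (l ++ l') = weightedSum k l + weightedSum (k + l.length) l' := by
  induction l generalizing k with
  | nil => simp [weightedSum]
  | cons a l ih =>
    simp only [List.cons_append, weightedSum, ih, List.length_cons]
    rw [show k + 1 + l.length = k + (l.length + 1) by ring]; ring

theorem weightedSum_succ (k : ℕ) (l : List ℕ) :
    weightedSum (k + 1) l = weightedSum k l + l.sum := by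
  induction l generalizing k with
  | nil => simp [weightedSum]
  | cons a l ih => simp only [weightedSum, ih, List.sum_cons]; ring

theorem weightedSum_eq_sum_range (k : ℕ) (l : List ℕ) :
    weightedSum k l = ∑ i ∈ Finset.range l.length, (i + k) * l.getD i 0 := by
  induction l generalizing k with
  | nil => simp [weightedSum]
  | cons a l ih =>
    rw [weightedSum, ih, List.length_cons, Finset.sum_range_succ']
    simp only [List.getD_cons_succ, List.getD_cons_zero]
    rw [add_comm]
    congr 1
    · exact Finset.sum_congr rfl fun i _ => by ring
    · ring

theorem vtSyndrome_eq (l : List ℕ) : vtSyndrome l = weightedSum 1 l % (l.length + 1) := by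
  rw [vtSyndrome, weightedSum_eq_sum_range]

theorem sum_le_length_of_binary {l : List ℕ} (h : ∀ a ∈ l, a ≤ 1) : l.sum ≤ l.length := by
  simpa using List.sum_le_card_nsmul l 1 h

theorem eq_replicate_zero {l : List ℕ} (hs : l.sum = 0) : l = List.replicate l.length 0 := by
  rw [List.eq_replicate_iff]
  exact ⟨rfl, fun b hb => List.sum_eq_zero_iff.1 hs b hb⟩

theorem eq_replicate_one {l : List ℕ} (h : ∀ a ∈ l, a ≤ 1) (hs : l.sum = l.length) :
    l = List.replicate l.length 1 := by
  induction l with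
  | nil => rfl
  | cons a l ih =>
    have h1 := sum_le_length_of_binary fun b hb => h b (List.mem_cons_of_mem _ hb)
    have h2 := h a (by simp)
    simp only [List.sum_cons, List.length_cons] at hs
    obtain rfl : a = 1 := by omega
    rw [List.length_cons, List.replicate_succ,
      ← ih (fun b hb => h b (List.mem_cons_of_mem _ hb)) (by omega)]

theorem replicate_append_cons (m c : ℕ) (l : List ℕ) :
    List.replicate m c ++ c :: l = c :: (List.replicate m c ++ l) := by
  rw [← List.cons_append, ← List.replicate_succ, List.replicate_succ']; simp

/-- Two ways of inserting a bit into a binary word that give the same syndrome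
give the same word; here the second bit is inserted to the right of the first. -/
theorem insert_eq_of_vtSyndrome_eq_aux {A M B : List ℕ} {c c' : ℕ}
    (hM : ∀ a ∈ M, a ≤ 1) (hc : c ≤ 1) (hc' : c' ≤ 1)
    (h : vtSyndrome (A ++ c :: (M ++ B)) = vtSyndrome (A ++ M ++ c' :: B)) :
    A ++ c :: (M ++ B) = A ++ M ++ c' :: B := by
  have hs := sum_le_length_of_binary hM
  rw [vtSyndrome_eq, vtSyndrome_eq] at h
  have e1 : weightedSum 1 (A ++ c :: (M ++ B)) = weightedSum 1 A + weightedSum (1 + A.length) M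
      + weightedSum (1 + A.length + M.length + 1) B + ((1 + A.length) * c + M.sum) := by
    rw [weightedSum_append, weightedSum, weightedSum_append, weightedSum_succ (1 + A.length) M,
      show 1 + A.length + 1 + M.length = 1 + A.length + M.length + 1 by ring]
    ring
  have e2 : weightedSum 1 (A ++ M ++ c' :: B) = weightedSum 1 A + weightedSum (1 + A.length) M
      + weightedSum (1 + A.length + M.length + 1) B + (1 + A.length + M.length) * c' := by
    rw [weightedSum_append, weightedSum, weightedSum_append, List.length_append,
      ← add_assoc 1 A.length]
    ring
  have e3 : (A ++ c :: (M ++ B)).length = A.length + M.length + B.length + 1 := by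
    simp; ring
  have e4 : (A ++ M ++ c' :: B).length = A.length + M.length + B.length + 1 := by
    simp; ring
  rw [e1, e2, e3, e4] at h
  -- Moving the inserted bit across `M` changes only these terms. Both sides are at most `1 + |A| +
  -- |M|`, below the modulus `|A| + |M| + |B| + 2`, so congruence forces equality.
  have h' : ((1 + A.length) * c + M.sum) = (1 + A.length + M.length) * c' := by
    have := Nat.ModEq.add_left_cancel' _ (show Nat.ModEq _ _ _ from h)
    refine Nat.ModEq.eq_of_lt_of_lt this ?_ ?_
    · interval_cases c <;> omega
    · interval_cases c' <;> omega
  -- Since `M.sum ≤ |M|`, unequal bits are impossible; equal bits force `M` to be constant with that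
  -- value, and the bit may slide through it.
  interval_cases c <;> interval_cases c'
  · rw [eq_replicate_zero (l := M) (by omega)]
    simp [replicate_append_cons]
  · omega
  · omega
  · rw [eq_replicate_one hM (by omega)]
    simp [replicate_append_cons]

theorem insert_eq_of_vtSyndrome_eq {A B A' B' : List ℕ} {c c' : ℕ} (hz : A ++ B = A' ++ B')
    (hb : ∀ a ∈ A ++ B, a ≤ 1) (hc : c ≤ 1) (hc' : c' ≤ 1)
    (h : vtSyndrome (A ++ c :: B) = vtSyndrome (A' ++ c' :: B')) :
    A ++ c :: B = A' ++ c' :: B' := by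
  rcases List.append_eq_append_iff.1 hz with ⟨M, rfl, rfl⟩ | ⟨M, rfl, rfl⟩
  · exact insert_eq_of_vtSyndrome_eq_aux (fun a ha => hb a (by simp [ha])) hc hc' h
  · exact (insert_eq_of_vtSyndrome_eq_aux (fun a ha => hb a (by simp [ha])) hc' hc h.symm).symm

/-! ### Inversion vectors under insertion of a symbol -/

theorem inversionVector_cons_cons (a b : ℕ) (l : List ℕ) :
    inversionVector (a :: b :: l) = (if b < a then 1 else 0) :: inversionVector (b :: l) := rfl

theorem length_inversionVector (w : List ℕ) : (inversionVector w).length = w.length - 1 := by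
  simp [inversionVector]

theorem inversionVector_le_one {w : List ℕ} : ∀ a ∈ inversionVector w, a ≤ 1 := by
  induction w with
  | nil => simp [inversionVector]
  | cons a w ih =>
    cases w with
    | nil => simp [inversionVector]
    | cons b w =>
      rw [inversionVector_cons_cons]
      intro x hx
      rcases List.mem_cons.1 hx with rfl | hx
      · split_ifs <;> simp
      · exact ih x hx

/-- Inserting a symbol into a nonempty word inserts a bit into its inversion vector. -/
theorem exists_inversionVector_insert (A B : List ℕ) (b : ℕ) (hne : A ++ B ≠ []) :
    ∃ P Q c, c ≤ 1 ∧ inversionVector (A ++ B) = P ++ Q ∧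
      inversionVector (A ++ b :: B) = P ++ c :: Q := by
  induction A with
  | nil =>
    obtain ⟨y, B, rfl⟩ := List.exists_cons_of_ne_nil hne
    refine ⟨[], inversionVector (y :: B), if y < b then 1 else 0, by split_ifs <;> simp, rfl, rfl⟩
  | cons a A ih =>
    cases A with
    | nil =>
      cases B with
      | nil => exact ⟨[], [], if b < a then 1 else 0, by split_ifs <;> simp, rfl, rfl⟩
      | cons y B =>
        simp only [List.cons_append, List.nil_append, inversionVector_cons_cons]
        -- The bit of `a, y` is replaced by those of `a, b` and `b, y`. By transitivity the old bit
        -- equals one of the two new ones, so the other is the inserted bit.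
        by_cases h1 : y < a <;> by_cases h2 : b < a <;> by_cases h3 : y < b <;>
          simp only [h1, h2, h3, if_true, if_false]
        · exact ⟨[], 1 :: inversionVector (y :: B), 1, le_rfl, rfl, rfl⟩
        · exact ⟨[1], inversionVector (y :: B), 0, by simp, rfl, rfl⟩
        · exact ⟨[], 1 :: inversionVector (y :: B), 0, by simp, rfl, rfl⟩
        · omega
        · omega
        · exact ⟨[], 0 :: inversionVector (y :: B), 1, by simp, rfl, rfl⟩
        · exact ⟨[0], inversionVector (y :: B), 1, by simp, rfl, rfl⟩
        · exact ⟨[], 0 :: inversionVector (y :: B), 0, by simp, rfl, rfl⟩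
    | cons a' A =>
      obtain ⟨P, Q, c, hc, h1, h2⟩ := ih (by simp)
      simp only [List.cons_append, inversionVector_cons_cons] at h1 h2 ⊢
      rw [h1, h2]
      exact ⟨_ :: P, Q, c, hc, rfl, rfl⟩

/-- The inversion bit at an index. -/
theorem getElem?_inversionVector {w : List ℕ} {i : ℕ} (h : i + 1 < w.length) :
    (inversionVector w)[i]? = some (if w[i + 1] < w[i] then 1 else 0) := by
  simp [inversionVector, List.getElem?_zipWith, h, show i < w.length by omega]

/-- A symbol cannot be moved in a word without repetition while keeping the inversion vector. -/
theorem eq_nil_of_inversionVector_eq {A M B : List ℕ} {b : ℕ} (hb : b ∉ M)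
    (h : inversionVector (A ++ b :: (M ++ B)) = inversionVector (A ++ M ++ b :: B)) : M = [] := by
  by_contra hM
  have hpos : 0 < M.length := List.length_pos_of_ne_nil hM
  -- `u` reads the cyclic-looking block `b M b`. From position `|A|` on, the first word shows `u 0,
  -- u 1, …` and the second `u 1, u 2, …`, so equality of inversion vectors says that consecutive
  -- comparisons in `u` agree.
  set u : ℕ → ℕ := fun t => (b :: (M ++ [b])).getD t 0 with hu
  have hu0 : u 0 = b := rfl
  have hul : u (M.length + 1) = b := by simp [hu]
  have hget1 : ∀ t ≤ M.length, (A ++ b :: (M ++ B))[A.length + t]? = some (u t) := by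
    intro t ht
    rw [List.getElem?_append_right (by omega), Nat.add_sub_cancel_left]
    rcases t with _ | t
    · rfl
    · simp [hu, List.getElem?_append_left (show t < M.length by omega), List.getD_eq_getElem?_getD,
        List.getElem?_eq_getElem (show t < M.length by omega)]
  have hget2 : ∀ t ≤ M.length, (A ++ M ++ b :: B)[A.length + t]? = some (u (t + 1)) := by
    intro t ht
    rw [List.append_assoc, List.getElem?_append_right (by omega), Nat.add_sub_cancel_left]
    rcases ht.lt_or_eq with ht | rfl
    · simp [hu, List.getElem?_append_left ht, List.getD_eq_getElem?_getD,
        List.getElem?_eq_getElem ht]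
    · simp [hu]
  have key : ∀ t < M.length, (u (t + 1) < u t ↔ u (t + 2) < u (t + 1)) := by
    intro t ht
    have h1 : (inversionVector _)[A.length + t]? = (inversionVector _)[A.length + t]? :=
      congrArg (fun l => l[A.length + t]?) h
    rw [getElem?_inversionVector (by simp; omega), getElem?_inversionVector (by simp; omega)] at h1
    have g1 := List.getElem_of_getElem? (hget1 t ht.le)
    have g2 := List.getElem_of_getElem? (hget1 (t + 1) ht)
    have g3 := List.getElem_of_getElem? (hget2 t ht.le)
    have g4 := List.getElem_of_getElem? (hget2 (t + 1) ht)
    obtain ⟨_, g1⟩ := g1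
    obtain ⟨_, g2⟩ := g2
    obtain ⟨_, g3⟩ := g3
    obtain ⟨_, g4⟩ := g4
    simp only [← add_assoc] at g2 g4
    rw [g1, g2, g3, g4] at h1
    rw [Option.some_inj] at h1
    clear_value u
    split_ifs at h1 with c1 c2 c2
    · exact iff_of_true c1 c2
    · exact iff_of_false c1 c2
  have all : ∀ t ≤ M.length, (u 1 < u 0 ↔ u (t + 1) < u t) := by
    intro t
    induction t with
    | zero => simp
    | succ t ih => intro ht; exact (ih (by omega)).trans (key t (by omega))
  -- All comparisons are descents, or none is. A strict descent from `b` to `b` is absurd; a weak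
  -- ascent from `b` to `b` is constant, which puts `b` in `M`.
  by_cases hlt : u 1 < u 0
  · have : ∀ t ≤ M.length, u (t + 1) < u 0 := by
      intro t
      induction t with
      | zero => intro; exact hlt
      | succ t ih => intro ht; exact ((all _ ht).1 hlt).trans (ih (by omega))
    have := this M.length le_rfl
    omega
  · have mono : ∀ t ≤ M.length, u 1 ≤ u (t + 1) := by
      intro t
      induction t with
      | zero => intro; exact le_rfl
      | succ t ih =>
        intro ht
        have := (all _ ht).not.1 hlt
        have := ih (by omega)
        omega
    have h1 := mono M.length le_rfl
    have h2 : u 1 = b := by omega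
    apply hb
    have h3 : u 1 = M[0] := by
      simp [hu, List.getD_eq_getElem?_getD, List.getElem_append_left hpos]
    rw [← h2, h3]
    exact List.getElem_mem hpos

/-- A word without repetition is determined by the word left after deleting one symbol, the
deleted symbol and the syndrome of the inversion vector. -/
theorem insert_symbol_unique {A B A' B' : List ℕ} {b : ℕ} (hy : A ++ B = A' ++ B')
    (hb : b ∉ A ++ B)
    (h : vtSyndrome (inversionVector (A ++ b :: B)) =
      vtSyndrome (inversionVector (A' ++ b :: B'))) :
    A ++ b :: B = A' ++ b :: B' := by
  by_cases hne : A ++ B = []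
  · have hne' := hne
    rw [hy] at hne'
    simp only [List.append_eq_nil_iff] at hne hne'
    simp [hne, hne']
  have hinv : inversionVector (A ++ b :: B) = inversionVector (A' ++ b :: B') := by
    obtain ⟨P, Q, c, hc, h1, h2⟩ := exists_inversionVector_insert A B b hne
    obtain ⟨P', Q', c', hc', h1', h2'⟩ := exists_inversionVector_insert A' B' b (hy ▸ hne)
    rw [h2, h2'] at h ⊢
    refine insert_eq_of_vtSyndrome_eq ?_ ?_ hc hc' h
    · rw [← h1, ← h1', hy]
    · rw [← h1]; exact inversionVector_le_one
  rcases List.append_eq_append_iff.1 hy with ⟨M, rfl, rfl⟩ | ⟨M, rfl, rfl⟩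
  · obtain rfl := eq_nil_of_inversionVector_eq (fun hm => hb (by simp [hm])) hinv
    simp
  · obtain rfl := eq_nil_of_inversionVector_eq (fun hm => hb (by simp [hm])) hinv.symm
    simp

theorem insertIdx_eq_append {y : List ℕ} {i b : ℕ} (hi : i ≤ y.length) :
    y.insertIdx i b = y.take i ++ b :: y.drop i := by
  induction y generalizing i with
  | nil => simp at hi; simp [hi]
  | cons a y ih =>
    cases i with
    | zero => simp
    | succ i => simp [ih (by simpa using hi)]

theorem exists_append_of_sublist {x y : List ℕ} (h : y.Sublist x) (hl : x.length = y.length + 1) :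
    ∃ A b B, x = A ++ b :: B ∧ y = A ++ B := by
  induction h with
  | slnil => simp at hl
  | @cons y x a h ih =>
    obtain rfl := h.eq_of_length (by simpa using hl.symm)
    exact ⟨[], a, y, rfl, rfl⟩
  | @cons_cons y x a h ih =>
    obtain ⟨A, b, B, rfl, rfl⟩ := ih (by simpa using hl)
    exact ⟨a :: A, b, B, rfl, rfl⟩

/-- Correction of a single deletion in a word without repetition. -/
theorem decodeSingle_eq {x y : List ℕ} (hx : x.Nodup) (h : y.Sublist x)
    (hl : x.length = y.length + 1) :
    decodeSingle x.length y (vtSyndrome (inversionVector x)) (checksum x) = x := by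
  obtain ⟨A, b, B, rfl, rfl⟩ := exists_append_of_sublist h hl
  have hb : b ∉ A ++ B := (List.nodup_middle.1 hx).notMem
  have hsum : checksum (A ++ b :: B) - checksum (A ++ B) = b := by
    simp only [checksum, List.sum_append, List.sum_cons]; omega
  have hmem : A ++ b :: B ∈
      (List.range (A ++ b :: B).length).map fun i => (A ++ B).insertIdx i b := by
    refine List.mem_map.2 ⟨A.length, by simp, ?_⟩
    rw [insertIdx_eq_append (by simp)]; simp
  rw [decodeSingle, hsum]
  cases hf : List.find? (fun w => vtSyndrome (inversionVector w) ==
      vtSyndrome (inversionVector (A ++ b :: B)))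
      ((List.range (A ++ b :: B).length).map fun i => (A ++ B).insertIdx i b) with
  -- The default of `getD` is never reached, since the original word is among the candidates.
  | none =>
    have := List.find?_eq_none.1 hf _ hmem
    simp at this
  | some w =>
    have h1 := List.find?_some hf
    obtain ⟨i, hi, rfl⟩ := List.mem_map.1 (List.mem_of_find?_eq_some hf)
    have hi' : i ≤ (A ++ B).length := by
      simp at hi ⊢; omega
    rw [insertIdx_eq_append hi'] at h1 ⊢
    rw [Option.getD_some]
    exact insert_symbol_unique (by simp) (by simpa using hb) (by simpa using h1)

end RankSync

namespace RankSync

/-! # The transcript of the protocol -/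

theorem centre_lt {m : ℕ} (h : 0 < m) : centre m < m := by
  unfold centre; omega

/-- The messages exchanged about the substring `x` with noisy version `y`. -/
def transcript (x y : List ℕ) : List Event :=
  if _h₀ : x.length ≤ y.length then []
  else if _h₁ : x.length = y.length + 1 then
    [.syndrome ((inversionVector x).length + 1) (vtSyndrome (inversionVector x)),
      .checksum (checksum x)]
  else
    if centralSymbol x ∈ y then
      let p := y.idxOf (centralSymbol x)
      .symbol (centralSymbol x) ::
        .feedback (matchedVerdict (centre x.length - (y.take p).length)
          (x.length - 1 - centre x.length - (y.drop (p + 1)).length)) ::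
        (transcript (leftHalf x) (y.take p) ++ transcript (rightHalf x) (y.drop (p + 1)))
    else
      .symbol (centralSymbol x) :: .feedback (missingVerdict (x.length - 1 - y.length)) ::
        transcript (removeCentre x) y
termination_by x.length
decreasing_by
  all_goals
    have := centre_lt (m := x.length) (by omega)
    simp only [leftHalf, rightHalf, removeCentre, List.length_take, List.length_drop,
      List.length_eraseIdx]
    try split_ifs
    all_goals omega

theorem transcript_of_le {x y : List ℕ} (h : x.length ≤ y.length) : transcript x y = [] := by
  rw [transcript, dif_pos h]

theorem transcript_single {x y : List ℕ} (h : x.length = y.length + 1) :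
    transcript x y = [.syndrome ((inversionVector x).length + 1) (vtSyndrome (inversionVector x)),
      .checksum (checksum x)] := by
  rw [transcript, dif_neg (by omega), dif_pos h]

theorem centralSymbol_append {A B : List ℕ} {c : ℕ}
    (hA : A.length = centre (A ++ c :: B).length) : centralSymbol (A ++ c :: B) = c := by
  rw [centralSymbol, ← hA]; simp [List.getD_eq_getElem?_getD]

theorem leftHalf_append {A B : List ℕ} {c : ℕ}
    (hA : A.length = centre (A ++ c :: B).length) : leftHalf (A ++ c :: B) = A := by
  rw [leftHalf, ← hA]; simp

theorem rightHalf_append {A B : List ℕ} {c : ℕ}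
    (hA : A.length = centre (A ++ c :: B).length) : rightHalf (A ++ c :: B) = B := by
  rw [rightHalf, ← hA]; simp [List.drop_append]

theorem removeCentre_append {A B : List ℕ} {c : ℕ}
    (hA : A.length = centre (A ++ c :: B).length) : removeCentre (A ++ c :: B) = A ++ B := by
  rw [removeCentre, ← hA]; simp [List.eraseIdx_append_of_length_le]

theorem idxOf_append_cons {A B : List ℕ} {c : ℕ} (h : c ∉ A) :
    (A ++ c :: B).idxOf c = A.length := by
  rw [List.idxOf_append_of_notMem h]; simp

theorem transcript_missing {A B y : List ℕ} {c : ℕ}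
    (hA : A.length = centre (A ++ c :: B).length) (hc : c ∉ y)
    (hl : y.length + 2 ≤ (A ++ c :: B).length) :
    transcript (A ++ c :: B) y = .symbol c ::
      .feedback (missingVerdict ((A ++ c :: B).length - 1 - y.length)) ::
        transcript (A ++ B) y := by
  rw [transcript, dif_neg (by omega), dif_neg (by omega), centralSymbol_append hA, if_neg hc,
    removeCentre_append hA]

theorem transcript_matched {A B A' B' : List ℕ} {c : ℕ}
    (hA : A.length = centre (A ++ c :: B).length) (hc : c ∉ A')
    (hl : (A' ++ c :: B').length + 2 ≤ (A ++ c :: B).length) :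
    transcript (A ++ c :: B) (A' ++ c :: B') = .symbol c ::
      .feedback (matchedVerdict (A.length - A'.length) (B.length - B'.length)) ::
        (transcript A A' ++ transcript B B') := by
  rw [transcript, dif_neg (by omega), dif_neg (by omega), centralSymbol_append hA,
    if_pos (by simp), leftHalf_append hA, rightHalf_append hA, idxOf_append_cons hc, ← hA]
  have h1 : (A' ++ c :: B').take A'.length = A' := by simp
  have h2 : (A' ++ c :: B').drop (A'.length + 1) = B' := by simp [List.drop_append]
  have h3 : (A ++ c :: B).length - 1 - A.length = B.length := by simp
  simp only [h1, h2, h3]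

theorem exists_centre_split (x : List ℕ) (h : 0 < x.length) :
    ∃ A c B, x = A ++ c :: B ∧ A.length = centre x.length := by
  have := centre_lt h
  exact ⟨x.take (centre x.length), x[centre x.length], x.drop (centre x.length + 1),
    by rw [List.cons_getElem_drop_succ, List.take_append_drop], by simp; omega⟩

/-- Induction along the run of the protocol, for a word `x` without repetition and a
subsequence `y` of `x`. -/
theorem protocol_induction {P : List ℕ → List ℕ → Prop}
    (clean : ∀ x, P x x)
    (single : ∀ x y, x.Nodup → y.Sublist x → x.length = y.length + 1 → P x y)
    (missing : ∀ A c B y, (A ++ c :: B).Nodup → A.length = centre (A ++ c :: B).length →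
      y.Sublist (A ++ B) → c ∉ y → y.length + 2 ≤ (A ++ c :: B).length → P (A ++ B) y →
      P (A ++ c :: B) y)
    (matched : ∀ A c B A' B', (A ++ c :: B).Nodup → A.length = centre (A ++ c :: B).length →
      A'.Sublist A → B'.Sublist B → c ∉ A' →
      (A' ++ c :: B').length + 2 ≤ (A ++ c :: B).length → P A A' → P B B' →
      P (A ++ c :: B) (A' ++ c :: B'))
    (x y : List ℕ) (hx : x.Nodup) (hy : y.Sublist x) : P x y := by
  induction hn : x.length using Nat.strong_induction_on generalizing x y with
  | _ n ih =>
  subst hn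
  rcases hy.length_le.eq_or_lt with h | h
  · rw [hy.eq_of_length h]; exact clean x
  rcases (Nat.succ_le_of_lt h).eq_or_lt with h | h
  · exact single x y hx hy h.symm
  obtain ⟨A, c, B, rfl, hA⟩ := exists_centre_split x (by omega)
  have hc := List.nodup_middle.1 hx
  have hcA : c ∉ A := fun h => hc.notMem (by simp [h])
  have hcB : c ∉ B := fun h => hc.notMem (by simp [h])
  obtain ⟨A', C, rfl, hA', hC⟩ := List.sublist_append_iff.1 hy
  rcases List.sublist_cons_iff.1 hC with hC | ⟨B', rfl, hB'⟩
  · refine missing A c B _ hx hA (hA'.append hC) ?_ h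
      (ih _ (by simp) _ _ hc.of_cons (hA'.append hC) rfl)
    intro hm
    rcases List.mem_append.1 hm with hm | hm
    · exact hcA (hA'.subset hm)
    · exact hcB (hC.subset hm)
  · exact matched A c B A' B' hx hA hA' hB' (fun h => hcA (hA'.subset h)) h
      (ih _ (by simp) _ _ (hx.sublist (by simp)) hA' rfl)
      (ih _ (by simp; omega) _ _ (hx.sublist (by simp)) hB' rfl)

theorem respond_missing {A B : List ℕ} {c k : ℕ} (hA : A.length = centre (A ++ c :: B).length)
    (hk : 1 ≤ k) : respond (A ++ c :: B) (missingVerdict k) = initialTasks k (A ++ B) := by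
  unfold missingVerdict initialTasks
  rw [if_neg (by omega : k ≠ 0)]
  split_ifs <;> simp [respond, removeCentre_append hA]

/-- The six matched verdicts tell clean, single and many apart in each half. With `dl + dr ≥ 2` this
is exactly the information the transmitter needs to start both halves afresh. -/
theorem respond_matched {A B : List ℕ} {c dl dr : ℕ}
    (hA : A.length = centre (A ++ c :: B).length) (hk : 2 ≤ dl + dr) :
    respond (A ++ c :: B) (matchedVerdict dl dr) = initialTasks dl A ++ initialTasks dr B := by
  unfold matchedVerdict initialTasks
  split_ifs <;> first | omega | simp [respond, leftHalf_append hA, rightHalf_append hA]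

/-- The receiver restores the substring and both sides then proceed in step. -/
theorem run_restore (x y : List ℕ) (hx : x.Nodup) (hy : y.Sublist x) :
    ∀ (next : List ℕ → Receiver) (rest : List Task),
      run (restore x.length y next) (initialTasks (x.length - y.length) x ++ rest) =
        ((run (next x) rest).1, transcript x y ++ (run (next x) rest).2) := by
  -- The induction keeps the continuation and the pending tasks arbitrary: the left half is run with
  -- the right half still waiting on both sides.
  refine protocol_induction (P := fun x y => ∀ (next : List ℕ → Receiver) (rest : List Task),
      run (restore x.length y next) (initialTasks (x.length - y.length) x ++ rest) =
        ((run (next x) rest).1, transcript x y ++ (run (next x) rest).2)) ?_ ?_ ?_ ?_ x y hx hy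
  · intro x next rest
    rw [restore, dif_pos le_rfl, transcript_of_le le_rfl]
    simp [initialTasks]
  · intro x y hx hy h next rest
    rw [restore, dif_neg (by omega), dif_pos h, transcript_single h,
      show x.length - y.length = 1 by omega]
    simp [initialTasks, run, decodeSingle_eq hx hy h]
  · intro A c B y hx hA hy hc hl ih next rest
    rw [restore, dif_neg (by omega), dif_neg (by omega), transcript_missing hA hc hl]
    have hlen : (A ++ c :: B).length - 1 = (A ++ B).length := by simp
    have htask : initialTasks ((A ++ c :: B).length - y.length) (A ++ c :: B) =
        [.sendCentre (A ++ c :: B)] := by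
      rw [initialTasks, if_neg (by omega), if_neg (by omega)]
    have hins : (A ++ B).insertIdx (centre (A ++ c :: B).length) c = A ++ c :: B := by
      rw [← hA, insertIdx_eq_append (by simp)]; simp
    have := ih (fun z => next (z.insertIdx (centre (A ++ c :: B).length) c)) rest
    rw [htask, List.cons_append, List.nil_append, run]
    simp only [centralSymbol_append hA, if_neg hc, run]
    rw [respond_missing hA (by omega), hlen, this, hins]
    simp
  · intro A c B A' B' hx hA hA' hB' hc hl ih1 ih2 next rest
    rw [restore, dif_neg (by omega), dif_neg (by omega), transcript_matched hA hc hl]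
    have htask : initialTasks ((A ++ c :: B).length - (A' ++ c :: B').length) (A ++ c :: B) =
        [.sendCentre (A ++ c :: B)] := by
      rw [initialTasks, if_neg (by omega), if_neg (by omega)]
    have h1 : (A' ++ c :: B').take A'.length = A' := by simp
    have h2 : (A' ++ c :: B').drop (A'.length + 1) = B' := by simp [List.drop_append]
    have h3 : (A ++ c :: B).length - 1 - A.length = B.length := by simp
    have hk : 2 ≤ (A.length - A'.length) + (B.length - B'.length) := by
      have := hA'.length_le
      have := hB'.length_le
      simp at hl
      omega
    rw [htask, List.cons_append, List.nil_append, run]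
    simp only [centralSymbol_append hA, if_pos (show c ∈ A' ++ c :: B' by simp),
      idxOf_append_cons hc, run, ← hA, h1, h2, h3]
    rw [respond_matched hA hk, List.append_assoc, ih1, ih2]
    simp

theorem limitedFeedback_eq {x y : List ℕ} (hx : x.Nodup) (hy : y.Sublist x) :
    limitedFeedback x.length (x.length - y.length) x y = (some x, transcript x y) := by
  have := run_restore x y hx hy .done []
  rw [List.append_nil] at this
  rw [limitedFeedback, this]
  simp [run]

end RankSync

namespace RankSync

/-! # Expected number of central symbols -/

/-- Each central symbol counts once. -/
def symbolWeight : Event → ℕ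
  | .symbol _ => 1
  | _ => 0

/-- Each announcement of an unmatched central symbol counts once. -/
def missingWeight : Event → ℕ
  | .feedback .missingSingle => 1
  | .feedback .missingMany => 1
  | _ => 0

/-- The number of central symbols sent. -/
def symbolCount (es : List Event) : ℕ := (es.map symbolWeight).sum

/-- The number of central symbols that the receiver could not match. -/
def missingCount (es : List Event) : ℕ := (es.map missingWeight).sum

theorem missingWeight_missingVerdict (k : ℕ) :
    missingWeight (.feedback (missingVerdict k)) = 1 := by
  unfold missingVerdict; split_ifs <;> rfl

theorem missingWeight_matchedVerdict (k l : ℕ) :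
    missingWeight (.feedback (matchedVerdict k l)) = 0 := by
  unfold matchedVerdict; split_ifs <;> rfl

/-! ### A binomial inequality for balanced halves -/

theorem choose_two_mul_le {a b : ℕ} (hab : b = a ∨ b = a + 1) :
    2 * a.choose 2 + 2 * b.choose 2 ≤ (a + b).choose 2 := by
  have h : ∀ m : ℕ, ((m.choose 2 : ℕ) : ℚ) = m * (m - 1) / 2 := fun m => Nat.cast_choose_two ℚ m
  rw [← Nat.cast_le (α := ℚ)]
  push_cast
  rw [h, h, h]
  have ha : (0 : ℚ) ≤ a := Nat.cast_nonneg a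
  rcases hab with rfl | rfl <;> push_cast <;> nlinarith

/-- This says that `k ≥ 2` uniformly random deletions among two balanced halves all fall into one
half with probability at most `1/2`. Passing from `k` to `k + 1` multiplies the binomial
coefficients by `(a - k)/(k + 1)`, `(b - k)/(k + 1)` and `(a + b - k)/(k + 1)`, the last being the
largest factor. -/
theorem choose_mul_le {a b k : ℕ} (hab : b = a ∨ b = a + 1) (hk : 2 ≤ k) :
    2 * a.choose k + 2 * b.choose k ≤ (a + b).choose k := by
  induction k, hk using Nat.le_induction with
  | base => exact choose_two_mul_le hab
  | succ k hk ih =>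
    have h1 := Nat.choose_succ_right_eq a k
    have h2 := Nat.choose_succ_right_eq b k
    have h3 := Nat.choose_succ_right_eq (a + b) k
    refine Nat.le_of_mul_le_mul_right (c := k + 1) ?_ (by omega)
    calc (2 * a.choose (k + 1) + 2 * b.choose (k + 1)) * (k + 1)
        = 2 * (a.choose k * (a - k)) + 2 * (b.choose k * (b - k)) := by rw [← h1, ← h2]; ring
      _ ≤ 2 * (a.choose k * (a + b - k)) + 2 * (b.choose k * (a + b - k)) := by
          gcongr <;> omega
      _ = (2 * a.choose k + 2 * b.choose k) * (a + b - k) := by ring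
      _ ≤ (a + b).choose k * (a + b - k) := by gcongr
      _ = _ := h3.symm

section SubsetSums

variable {α : Type*} [DecidableEq α]

theorem sum_powersetCard_insert {c : α} {X : Finset α} (hc : c ∉ X) (k : ℕ)
    (f : Finset α → ℝ) :
    ∑ S ∈ (insert c X).powersetCard (k + 1), f S =
      ∑ S ∈ X.powersetCard (k + 1), f S + ∑ S ∈ X.powersetCard k, f (insert c S) := by
  have hmem : ∀ {j : ℕ} {S}, S ∈ X.powersetCard j → c ∉ S := fun hS h =>
    hc ((Finset.mem_powersetCard.1 hS).1 h)
  rw [Finset.powersetCard_succ_insert hc, Finset.sum_union, Finset.sum_image]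
  · intro S hS T hT h
    rw [← Finset.erase_insert (hmem hS), ← Finset.erase_insert (hmem hT), h]
  · rw [Finset.disjoint_left]
    intro S hS hS'
    obtain ⟨T, -, rfl⟩ := Finset.mem_image.1 hS'
    exact hmem hS (Finset.mem_insert_self c T)

/-- If a function on subsets has nonpositive average over the subsets of each size of `X`, it has
nonpositive average over the traces on `X` of the subsets of each size of a larger set. -/
theorem sum_powersetCard_inter_nonpos {X : Finset α} {g : Finset α → ℝ}
    (h : ∀ k, ∑ S ∈ X.powersetCard k, g S ≤ 0) (Y : Finset α) (hXY : Disjoint X Y) :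
    ∀ k, ∑ S ∈ (X ∪ Y).powersetCard k, g (S ∩ X) ≤ 0 := by
  induction Y using Finset.induction_on with
  | empty =>
    intro k
    rw [Finset.union_empty]
    refine le_of_eq_of_le (Finset.sum_congr rfl fun S hS => ?_) (h k)
    rw [Finset.inter_eq_left.2 (Finset.mem_powersetCard.1 hS).1]
  | insert c Y hc ih =>
    rw [Finset.disjoint_insert_right] at hXY
    intro k
    rw [Finset.union_insert]
    -- Adding one outside element `c` splits the subsets by whether they contain `c`; the trace on
    -- `X` does not see it.
    cases k with
    | zero => simpa using h 0
    | succ k =>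
      rw [sum_powersetCard_insert (by simp [hXY.1, hc])]
      have h1 := ih hXY.2 (k + 1)
      have h2 := ih hXY.2 k
      simp only [Finset.insert_inter_of_notMem hXY.1]
      linarith

theorem sum_inter_eq_empty {X Y : Finset α} (hXY : Disjoint X Y) (k : ℕ) :
    ∑ S ∈ (X ∪ Y).powersetCard k, (if S ∩ X = ∅ then (1 : ℝ) else 0) = Y.card.choose k := by
  rw [Finset.sum_boole, ← Finset.card_powersetCard]
  congr 2
  ext S
  simp only [Finset.mem_filter, Finset.mem_powersetCard]
  constructor
  · rintro ⟨⟨h1, h2⟩, h3⟩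
    refine ⟨fun a ha => ?_, h2⟩
    rcases Finset.mem_union.1 (h1 ha) with h | h
    · exact absurd (Finset.mem_inter.2 ⟨ha, h⟩) (by simp [h3])
    · exact h
  · rintro ⟨h1, h2⟩
    exact ⟨⟨h1.trans Finset.subset_union_right, h2⟩,
      Finset.disjoint_iff_inter_eq_empty.1 (hXY.symm.mono_left h1)⟩

end SubsetSums

/-! ### Central symbols counted over sets of deleted symbols -/

/-- The word `x` with the symbols in `S` deleted. -/
def deleteSymbols (x : List ℕ) (S : Finset ℕ) : List ℕ := x.filter (· ∉ S)

theorem deleteSymbols_sublist (x : List ℕ) (S : Finset ℕ) : (deleteSymbols x S).Sublist x :=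
  List.filter_sublist

theorem length_deleteSymbols {x : List ℕ} (hx : x.Nodup) {S : Finset ℕ} (hS : S ⊆ x.toFinset) :
    (deleteSymbols x S).length = x.length - S.card := by
  rw [← List.toFinset_card_of_nodup (hx.sublist (deleteSymbols_sublist x S)),
    ← List.toFinset_card_of_nodup hx, ← Finset.card_sdiff_of_subset hS]
  congr 1
  ext a
  simp [deleteSymbols]

theorem deleteSymbols_congr {x : List ℕ} {S T : Finset ℕ} (h : ∀ a ∈ x, (a ∈ S ↔ a ∈ T)) :
    deleteSymbols x S = deleteSymbols x T :=
  List.filter_congr fun a ha => by simp [h a ha]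

/-- The number of central symbols, where unmatched ones count twice. -/
def symbolCost (x : List ℕ) (S : Finset ℕ) : ℕ :=
  symbolCount (transcript x (deleteSymbols x S)) + missingCount (transcript x (deleteSymbols x S))

/-- The bound for the expectation of `symbolCost` under `k` deletions. -/
def symbolBound (k : ℕ) : ℝ := if k = 0 then 0 else 2 * (k - 1)

theorem symbolCost_congr {x : List ℕ} {S T : Finset ℕ} (h : ∀ a ∈ x, (a ∈ S ↔ a ∈ T)) :
    symbolCost x S = symbolCost x T := by
  rw [symbolCost, symbolCost, deleteSymbols_congr h]

theorem symbolCost_missing {A B : List ℕ} {c k : ℕ} {S : Finset ℕ} (hx : (A ++ c :: B).Nodup)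
    (hA : A.length = centre (A ++ c :: B).length) (hS : S ∈ (A ++ B).toFinset.powersetCard (k + 1)) :
    symbolCost (A ++ c :: B) (insert c S) = symbolCost (A ++ B) S + 2 := by
  have hc := List.nodup_middle.1 hx
  obtain ⟨hS, hcard⟩ := Finset.mem_powersetCard.1 hS
  have hle := Finset.card_le_card hS
  rw [List.toFinset_card_of_nodup hc.of_cons] at hle
  have hdel : deleteSymbols (A ++ c :: B) (insert c S) = deleteSymbols (A ++ B) S := by
    rw [deleteSymbols_congr (x := A ++ B) (S := S) (T := insert c S)]
    · simp [deleteSymbols]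
    · intro a ha
      have : a ≠ c := fun h => hc.notMem (h ▸ ha)
      simp [this]
  have hlen := length_deleteSymbols hc.of_cons hS
  have hcy : c ∉ deleteSymbols (A ++ B) S :=
    fun h => hc.notMem ((deleteSymbols_sublist _ _).subset h)
  rw [symbolCost, hdel, transcript_missing hA hcy (by simp at hle hlen ⊢; omega), symbolCost]
  simp only [symbolCount, missingCount, List.map_cons, List.sum_cons,
    missingWeight_missingVerdict]
  simp only [symbolWeight, missingWeight]
  ring

theorem symbolCost_matched {A B : List ℕ} {c k : ℕ} {S : Finset ℕ} (hx : (A ++ c :: B).Nodup)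
    (hA : A.length = centre (A ++ c :: B).length) (hS : S ∈ (A ++ B).toFinset.powersetCard (k + 2)) :
    symbolCost (A ++ c :: B) S = symbolCost A S + symbolCost B S + 1 := by
  have hc := List.nodup_middle.1 hx
  obtain ⟨hS, hcard⟩ := Finset.mem_powersetCard.1 hS
  have hle := Finset.card_le_card hS
  rw [List.toFinset_card_of_nodup hc.of_cons] at hle
  have hcS : c ∉ S := fun h => hc.notMem (List.mem_toFinset.1 (hS h))
  have hdel : deleteSymbols (A ++ c :: B) S = deleteSymbols A S ++ c :: deleteSymbols B S := by
    simp [deleteSymbols, hcS]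
  have hlen := length_deleteSymbols hx (S := S) (hS.trans (by
    intro a; simp; tauto))
  have hcy : c ∉ deleteSymbols A S :=
    fun h => hc.notMem (List.mem_append_left _ ((deleteSymbols_sublist _ _).subset h))
  rw [hdel] at hlen
  rw [symbolCost, hdel, transcript_matched hA hcy (by simp at hle hlen ⊢; omega), symbolCost,
    symbolCost]
  simp only [symbolCount, missingCount, List.map_cons, List.sum_cons, List.map_append,
    List.sum_append, missingWeight_matchedVerdict]
  simp only [symbolWeight, missingWeight]
  ring

theorem symbolCost_eq_zero {x : List ℕ} (hx : x.Nodup) {S : Finset ℕ} (hS : S ⊆ x.toFinset)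
    (hcard : S.card ≤ 1) : symbolCost x S = 0 := by
  have hlen := length_deleteSymbols hx hS
  have h := (deleteSymbols_sublist x S).length_le
  rcases (show x.length ≤ (deleteSymbols x S).length ∨
    x.length = (deleteSymbols x S).length + 1 by omega) with h | h
  · simp [symbolCost, transcript_of_le h, symbolCount, missingCount]
  · simp [symbolCost, transcript_single h, symbolCount, missingCount, symbolWeight, missingWeight]

/-- Without truncation at zero the left side would be `-1`; each half free of deletions adds 2,
because its bound is 0 and not `2 (0 - 1)`. -/
theorem symbolBound_add {i j k : ℕ} (hk : 2 ≤ k) (h : i + j = k) :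
    1 + symbolBound i + symbolBound j - symbolBound k =
      -1 + 2 * (if i = 0 then 1 else 0) + 2 * (if j = 0 then 1 else 0) := by
  subst h
  unfold symbolBound
  rw [if_neg (by omega : i + j ≠ 0)]
  split_ifs <;> first | omega | (push_cast; simp_all; try ring)

/-- Over all patterns of `k` deletions, the average of `symbolCost` is at most `symbolBound k`. -/
theorem sum_symbolCost_sub_nonpos (x : List ℕ) (hx : x.Nodup) (k : ℕ) :
    ∑ S ∈ x.toFinset.powersetCard k, ((symbolCost x S : ℝ) - symbolBound S.card) ≤ 0 := by
  induction hn : x.length using Nat.strong_induction_on generalizing x k with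
  | _ n ih =>
  subst hn
  -- With at most one deletion no central symbol is sent.
  rcases le_or_gt k 1 with hk | hk
  · refine Finset.sum_nonpos fun S hS => ?_
    obtain ⟨hS, hcard⟩ := Finset.mem_powersetCard.1 hS
    rw [symbolCost_eq_zero hx hS (by omega), symbolBound]
    split_ifs with h
    · simp
    · have : S.card = 1 := by omega
      simp [this]
  obtain ⟨k, rfl⟩ : ∃ l, k = l + 2 := ⟨k - 2, by omega⟩
  rcases Nat.eq_zero_or_pos x.length with h0 | h0
  · obtain rfl := List.length_eq_zero_iff.1 h0
    rw [List.toFinset_nil, Finset.powersetCard_eq_empty.2 (by simp), Finset.sum_empty]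
  obtain ⟨A, c, B, rfl, hA⟩ := exists_centre_split x h0
  have hc := List.nodup_middle.1 hx
  have hAB : Disjoint A.toFinset B.toFinset := by
    rw [List.disjoint_toFinset_iff_disjoint]
    exact List.disjoint_of_nodup_append hc.of_cons
  have hins : (A ++ c :: B).toFinset = insert c (A ++ B).toFinset := by
    ext a; simp
  have hunion : (A ++ B).toFinset = A.toFinset ∪ B.toFinset := List.toFinset_append
  have hNA : A.Nodup := hx.sublist (by simp)
  have hNB : B.Nodup := hx.sublist (by simp)
  rw [hins, sum_powersetCard_insert (by simpa using hc.notMem)]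
  have hmissing : ∑ S ∈ (A ++ B).toFinset.powersetCard (k + 1),
      ((symbolCost (A ++ c :: B) (insert c S) : ℝ) - symbolBound (insert c S).card) ≤ 0 := by
    refine le_of_eq_of_le (Finset.sum_congr rfl fun S hS => ?_)
      (ih _ (by simp) (A ++ B) hc.of_cons (k + 1) rfl)
    rw [symbolCost_missing hx hA hS]
    obtain ⟨hS, hcard⟩ := Finset.mem_powersetCard.1 hS
    rw [Finset.card_insert_of_notMem fun h => hc.notMem (List.mem_toFinset.1 (hS h)), hcard,
      symbolBound, symbolBound, if_neg (by omega), if_neg (by omega)]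
    push_cast
    ring
  have hmatched : ∑ S ∈ (A ++ B).toFinset.powersetCard (k + 2),
      ((symbolCost (A ++ c :: B) S : ℝ) - symbolBound S.card) ≤ 0 := by
    -- The cost depends on each half only through the trace of the pattern there, so the difference
    -- splits into two terms handled by induction and the excess of `symbolBound_add`.
    have hsplit : ∀ S ∈ (A ++ B).toFinset.powersetCard (k + 2),
        (symbolCost (A ++ c :: B) S : ℝ) - symbolBound S.card =
        ((symbolCost A (S ∩ A.toFinset) : ℝ) - symbolBound (S ∩ A.toFinset).card) +
        ((symbolCost B (S ∩ B.toFinset) : ℝ) - symbolBound (S ∩ B.toFinset).card) +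
        (-1 + 2 * (if S ∩ A.toFinset = ∅ then 1 else 0) +
          2 * (if S ∩ B.toFinset = ∅ then 1 else 0)) := by
      intro S hS
      rw [symbolCost_matched hx hA hS]
      obtain ⟨hS, hcard⟩ := Finset.mem_powersetCard.1 hS
      have hadd : (S ∩ A.toFinset).card + (S ∩ B.toFinset).card = S.card := by
        rw [← Finset.card_union_of_disjoint
          (hAB.mono Finset.inter_subset_right Finset.inter_subset_right),
          ← Finset.inter_union_distrib_left, ← hunion, Finset.inter_eq_left.2 hS]
      have := symbolBound_add (by omega) hadd
      simp only [Finset.card_eq_zero] at this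
      rw [symbolCost_congr (x := A) (S := S) (T := S ∩ A.toFinset) (by simp +contextual),
        symbolCost_congr (x := B) (S := S) (T := S ∩ B.toFinset) (by simp +contextual)]
      push_cast
      linarith
    rw [Finset.sum_congr rfl hsplit, hunion]
    -- The trace of a random pattern on a half has random size, but is uniform given its size; the
    -- induction hypothesis is therefore needed for every `j`.
    have h1 := sum_powersetCard_inter_nonpos
      (fun j => ih _ (by simp) A hNA j rfl) B.toFinset hAB (k + 2)
    have h2 := sum_powersetCard_inter_nonpos
      (fun j => ih _ (by simp; omega) B hNB j rfl) A.toFinset hAB.symm (k + 2)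
    have h3 := sum_inter_eq_empty hAB (k + 2)
    have h4 := sum_inter_eq_empty hAB.symm (k + 2)
    rw [Finset.union_comm] at h2 h4
    have h5 : ((2 * A.length.choose (k + 2) + 2 * B.length.choose (k + 2) : ℕ) : ℝ) ≤
        ((A.length + B.length).choose (k + 2) : ℕ) := by
      rw [Nat.cast_le]
      refine choose_mul_le ?_ (by omega)
      simp [centre] at hA
      omega
    rw [Finset.sum_add_distrib, Finset.sum_add_distrib, Finset.sum_add_distrib,
      Finset.sum_add_distrib, Finset.sum_const, ← Finset.mul_sum, ← Finset.mul_sum, h3, h4,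
      Finset.card_powersetCard, Finset.card_union_of_disjoint hAB,
      List.toFinset_card_of_nodup hNA, List.toFinset_card_of_nodup hNB, nsmul_eq_mul]
    push_cast at h5
    linarith
  linarith

end RankSync

namespace RankSync

/-! # The cost of a run -/

theorem feedbackCost_feedback (v : Verdict) : feedbackCost (.feedback v) = 3 := by
  rw [feedbackCost, card_verdict, show ((8 : ℕ) : ℝ) = 2 ^ (3 : ℝ) by norm_num,
    Real.logb_rpow (by norm_num) (by norm_num)]

/-- Each central symbol is answered by one feedback message. -/
theorem sum_feedbackCost (x y : List ℕ) (hx : x.Nodup) (hy : y.Sublist x) :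
    ((transcript x y).map feedbackCost).sum = 3 * symbolCount (transcript x y) := by
  refine protocol_induction
    (P := fun x y => ((transcript x y).map feedbackCost).sum = 3 * symbolCount (transcript x y))
    ?_ ?_ ?_ ?_ x y hx hy
  · intro x
    simp [transcript_of_le, symbolCount]
  · intro x y _ _ h
    simp [transcript_single h, symbolCount, symbolWeight, feedbackCost]
  · intro A c B y _ hA _ hc hl ih
    rw [transcript_missing hA hc hl]
    simp only [symbolCount, List.map_cons, List.sum_cons, feedbackCost_feedback] at ih ⊢
    rw [ih]
    simp only [symbolWeight, feedbackCost]
    push_cast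
    ring
  · intro A c B A' B' _ hA _ _ hc hl ih1 ih2
    rw [transcript_matched hA hc hl]
    simp only [symbolCount, List.map_cons, List.sum_cons, List.map_append, List.sum_append,
      feedbackCost_feedback] at ih1 ih2 ⊢
    rw [ih1, ih2]
    simp only [symbolWeight, feedbackCost]
    push_cast
    ring

/-- The cost of the syndrome and the checksum of a word. -/
noncomputable def codeCost (p : List ℕ) : ℝ :=
  Real.logb 2 (p.length : ℕ) + Real.logb 2 (p.sum : ℕ)

/-- `pieces` are the substrings whose syndrome and checksum were sent while restoring `x` from a
version with `k` deletions with the messages `es`. -/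
structure IsCodedPieces (n : ℕ) (x : List ℕ) (k : ℕ) (es : List Event)
    (pieces : List (List ℕ)) : Prop where
  cost : (es.map (forwardCost n)).sum =
    symbolCount es * Real.logb 2 n + (pieces.map codeCost).sum
  length_add : pieces.length + missingCount es = k
  flatten_length : pieces.flatten.length + symbolCount es ≤ x.length
  subperm : pieces.flatten.Subperm x
  ne_nil : ∀ p ∈ pieces, p ≠ []
  missing_le : missingCount es ≤ symbolCount es
  one_le : 2 ≤ k → 1 ≤ symbolCount es

/-- Each deletion is settled either by a coded piece or by an unmatched centre, and every central
symbol sent is absent from all pieces; this gives `length_add` and `flatten_length`. -/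
theorem exists_isCodedPieces (n : ℕ) (x y : List ℕ) (hx : x.Nodup) (hy : y.Sublist x) :
    ∃ pieces, IsCodedPieces n x (x.length - y.length) (transcript x y) pieces := by
  refine protocol_induction
    (P := fun x y => ∃ pieces, IsCodedPieces n x (x.length - y.length) (transcript x y) pieces)
    ?_ ?_ ?_ ?_ x y hx hy
  · intro x
    refine ⟨[], ?_⟩
    rw [transcript_of_le le_rfl]
    constructor <;> simp [symbolCount, missingCount]
  · intro x y _ _ h
    refine ⟨[x], ?_⟩
    have hlen : (inversionVector x).length + 1 = x.length := by
      rw [length_inversionVector]; omega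
    rw [transcript_single h, hlen]
    constructor
    · simp [forwardCost, symbolCount, symbolWeight, codeCost, checksum]
    · simp [missingCount, missingWeight]; omega
    · simp [symbolCount, symbolWeight]
    · simpa using List.Subperm.refl x
    · rintro p hp rfl
      rw [← List.mem_singleton.1 hp] at h
      simp at h
    · simp [missingCount, missingWeight]
    · omega
  · intro A c B y _ hA hy hc hl ⟨pieces, h⟩
    refine ⟨pieces, ?_⟩
    rw [transcript_missing hA hc hl]
    have hle := hy.length_le
    have hm : ∀ es, missingCount (.symbol c ::
        .feedback (missingVerdict ((A ++ c :: B).length - 1 - y.length)) :: es) =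
          missingCount es + 1 := by
      intro es
      simp only [missingCount, List.map_cons, List.sum_cons, missingWeight_missingVerdict]
      simp only [missingWeight]
      ring
    have hs : ∀ v es, symbolCount (.symbol c :: .feedback v :: es) = symbolCount es + 1 := by
      intro v es
      simp only [symbolCount, List.map_cons, List.sum_cons, symbolWeight]
      ring
    have h1 := h.length_add
    have h2 := h.flatten_length
    have h3 := h.missing_le
    simp only [List.length_append, List.length_cons] at h1 h2 hl hle
    constructor
    · rw [hs]
      simp only [List.map_cons, List.sum_cons, forwardCost, h.cost]
      push_cast
      ring
    · rw [hm]; simp only [List.length_append, List.length_cons]; omega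
    · rw [hs]; simp only [List.length_append, List.length_cons]; omega
    · exact h.subperm.trans (List.Sublist.subperm (by simp))
    · exact h.ne_nil
    · rw [hm, hs]; omega
    · rw [hs]; omega
  · intro A c B A' B' _ hA hA' hB' hc hl ⟨pieces, h⟩ ⟨pieces', h'⟩
    refine ⟨pieces ++ pieces', ?_⟩
    rw [transcript_matched hA hc hl]
    have hle := hA'.length_le
    have hle' := hB'.length_le
    have hm : ∀ k l es es', missingCount (.symbol c :: .feedback (matchedVerdict k l) ::
        (es ++ es')) = missingCount es + missingCount es' := by
      intro k l es es'
      simp only [missingCount, List.map_cons, List.sum_cons, missingWeight_matchedVerdict,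
        List.map_append, List.sum_append]
      simp only [missingWeight]
      ring
    have hs : ∀ v es es', symbolCount (.symbol c :: .feedback v :: (es ++ es')) =
        symbolCount es + symbolCount es' + 1 := by
      intro v es es'
      simp only [symbolCount, List.map_cons, List.sum_cons, symbolWeight,
        List.map_append, List.sum_append]
      ring
    have h1 := h.length_add
    have h2 := h.flatten_length
    have h3 := h.missing_le
    have h1' := h'.length_add
    have h2' := h'.flatten_length
    have h3' := h'.missing_le
    constructor
    · rw [hs]
      simp only [List.map_cons, List.sum_cons, forwardCost, List.map_append, List.sum_append,
        h.cost, h'.cost]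
      push_cast
      ring
    · rw [hm]; simp only [List.length_append, List.length_cons]; omega
    · rw [hs]; simp only [List.length_append, List.length_cons, List.flatten_append]; omega
    · rw [List.flatten_append]
      exact (h.subperm.append h'.subperm).trans (List.Sublist.subperm (by simp))
    · intro p hp
      rcases List.mem_append.1 hp with hp | hp
      · exact h.ne_nil p hp
      · exact h'.ne_nil p hp
    · rw [hm, hs]; omega
    · rw [hs]; omega

/-! ### Estimates for checksums and logarithms -/

/-- A set of `q` numbers in `{1, …, n}` has sum at most `n + (n - 1) + … + (n - q + 1)`. -/
theorem two_mul_sum_add_sq_le (n : ℕ) (s : Finset ℕ) (hs : s ⊆ Finset.Icc 1 n) :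
    2 * ∑ i ∈ s, i + s.card ^ 2 ≤ s.card * (2 * n + 1) := by
  induction n generalizing s with
  | zero => simp at hs; simp [hs]
  | succ n ih =>
    by_cases h : n + 1 ∈ s
    · have hsub : s.erase (n + 1) ⊆ Finset.Icc 1 n := by
        intro a ha
        have h1 := Finset.ne_of_mem_erase ha
        have h2 := Finset.mem_Icc.1 (hs (Finset.mem_of_mem_erase ha))
        exact Finset.mem_Icc.2 (by omega)
      have h1 := ih _ hsub
      have h2 := Finset.add_sum_erase s (fun i => i) h
      have h3 := Finset.card_erase_add_one h
      rw [← h2, ← h3]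
      nlinarith
    · have hsub : s ⊆ Finset.Icc 1 n := by
        intro a ha
        have h1 : a ≠ n + 1 := fun h' => h (h' ▸ ha)
        have h2 := Finset.mem_Icc.1 (hs ha)
        exact Finset.mem_Icc.2 (by omega)
      have := ih _ hsub
      nlinarith

/-- The graph of the logarithm lies below its tangent at `μ`. -/
theorem sum_log_le_tangent {l : List ℝ} (hl : ∀ a ∈ l, 0 < a) {μ : ℝ} (hμ : 0 < μ) :
    (l.map Real.log).sum ≤ l.length * (Real.log μ - 1) + l.sum / μ := by
  induction l with
  | nil => simp
  | cons a l ih =>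
    have h1 := ih fun b hb => hl b (List.mem_cons_of_mem _ hb)
    have ha := hl a (by simp)
    have h2 := Real.log_le_sub_one_of_pos (div_pos ha hμ)
    rw [Real.log_div ha.ne' hμ.ne'] at h2
    simp only [List.map_cons, List.sum_cons, List.length_cons, add_div]
    push_cast
    linarith

/-- Jensen's inequality for the logarithm, applied to a list extended by `m` ones. -/
theorem sum_log_le {l : List ℝ} (hl : ∀ a ∈ l, 0 < a) (m : ℕ) {μ : ℝ} (hμ : 0 < μ)
    (h : l.sum + m ≤ (l.length + m) * μ) :
    (l.map Real.log).sum ≤ (l.length + m) * Real.log μ := by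
  have h1 := sum_log_le_tangent hl hμ
  have h2 : (m : ℝ) * 0 ≤ m * (Real.log μ + 1 / μ - 1) := by
    have := Real.log_le_sub_one_of_pos (div_pos one_pos hμ)
    rw [Real.log_div one_ne_zero hμ.ne', Real.log_one] at this
    exact mul_le_mul_of_nonneg_left (by linarith) (Nat.cast_nonneg m)
  have h3 : l.sum / μ + m * (1 / μ) ≤ l.length + m := by
    rw [mul_one_div, ← add_div, div_le_iff₀ hμ]; exact h
  linarith

/-- What `log_numeric_le` reduces to for `m ≥ 1`: the amount by which the checksum scale `(n + m +
1)/2` exceeds `n/2` is paid for by the unmatched centres. -/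
theorem log_two_mul_le {n m j : ℕ} (hn : 2 ≤ n) (hm : 1 ≤ m) (hj : j + m ≤ n) :
    (j : ℝ) * Real.log ((n + m + 1) / n) ≤ m * (2 * Real.log n - Real.log 2) := by
  have hn0 : (0 : ℝ) < n := by positivity
  have hl2 := Real.log_two_gt_d9
  -- The estimate `h2` fails at `n = 2`, where the claim is sharp for `m = j = 1`.
  rcases hn.eq_or_lt with rfl | hn3
  · obtain rfl | rfl : m = 1 ∨ m = 2 := by omega
    · have : (j : ℝ) ≤ 1 := by exact_mod_cast (by omega : j ≤ 1)
      norm_num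
      nlinarith
    · obtain rfl : j = 0 := by omega
      push_cast
      nlinarith
  have h1 : Real.log ((n + m + 1) / n) ≤ (m + 1) / n := by
    have := Real.log_le_sub_one_of_pos (show (0 : ℝ) < (n + m + 1) / n by positivity)
    have h2 : ((n : ℝ) + m + 1) / n - 1 = (m + 1) / n := by field_simp; ring
    linarith
  have h2 : (2 : ℝ) - 2 / n ≤ 2 * Real.log n - Real.log 2 := by
    rcases (show 3 ≤ n from hn3).eq_or_lt with rfl | hn4
    · have h8 : Real.log 8 = 3 * Real.log 2 := by
        rw [show (8 : ℝ) = 2 ^ 3 by norm_num, Real.log_pow]; norm_num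
      have : Real.log 8 ≤ Real.log (3 ^ 2) := Real.log_le_log (by norm_num) (by norm_num)
      rw [Real.log_pow] at this
      push_cast at this ⊢
      linarith
    · have : Real.log 4 = 2 * Real.log 2 := by
        rw [show (4 : ℝ) = 2 ^ 2 by norm_num, Real.log_pow]; norm_num
      have h4 : Real.log 4 ≤ Real.log n :=
        Real.log_le_log (by norm_num) (by exact_mod_cast hn4)
      have : (0 : ℝ) < 2 / n := by positivity
      linarith
  have hm' : (1 : ℝ) ≤ m := by exact_mod_cast hm
  have hj' : (j : ℝ) ≤ n - m := by
    have : (j : ℝ) + m ≤ n := by exact_mod_cast hj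
    linarith
  calc (j : ℝ) * Real.log ((n + m + 1) / n) ≤ (n - m) * ((m + 1) / n) := by
        refine mul_le_mul hj' h1 (Real.log_nonneg ?_) ?_
        · rw [le_div_iff₀ hn0]; linarith
        · have : (0 : ℝ) ≤ j := Nat.cast_nonneg j
          linarith
    _ ≤ m * (2 - 2 / n) := by
        rw [← sub_nonneg]
        have : (m : ℝ) * (2 - 2 / n) - (n - m) * ((m + 1) / n) = (m - 1) * (n + m) / n := by
          field_simp; ring
        rw [this]
        have : (0 : ℝ) ≤ m - 1 := by linarith
        positivity
    _ ≤ _ := mul_le_mul_of_nonneg_left h2 (by linarith)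

theorem log_numeric_le {n d m j e : ℕ} (hd : 2 ≤ d) (hdn : d ≤ n) (hjm : j + m = d)
    (he : e = max m 1) :
    2 * (d * Real.log (((n : ℝ) - e + m) / d)) + j * Real.log (((n : ℝ) + e + 1) / 2) ≤
      m * Real.log n + 3 * d * Real.log n - 2 * d * Real.log d - d * Real.log 2 := by
  have hn0 : (0 : ℝ) < n := by exact_mod_cast (by omega : 0 < n)
  have hd0 : (0 : ℝ) < d := by exact_mod_cast (by omega : 0 < d)
  rcases Nat.eq_zero_or_pos m with rfl | hm
  · obtain rfl : e = 1 := by simpa using he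
    obtain rfl : j = d := by simpa using hjm
    have hn1 : (0 : ℝ) < n - 1 := by
      have : (1 : ℝ) < n := by exact_mod_cast (by omega : 1 < n)
      linarith
    -- `(n - 1)² (n + 2) = n³ - 3 n + 2`. The gain needed here comes from the one symbol that is
    -- always excluded from the pieces, i.e. from `e = 1` when `m = 0`.
    have h1 : Real.log ((n - 1) ^ 2 * (n + 2)) ≤ Real.log ((n : ℝ) ^ 3) := by
      apply Real.log_le_log (by positivity)
      nlinarith
    rw [Real.log_mul (by positivity) (by positivity), Real.log_pow, Real.log_pow] at h1
    have h2 := mul_le_mul_of_nonneg_left h1 hd0.le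
    push_cast at h2 ⊢
    rw [add_zero, show (n : ℝ) + 1 + 1 = n + 2 by ring, Real.log_div hn1.ne' hd0.ne',
      Real.log_div (by positivity) two_ne_zero]
    linarith
  · obtain rfl : e = m := by omega
    have h := log_two_mul_le (n := n) (m := e) (j := j) (by omega) hm (by omega)
    have hd' : (d : ℝ) = j + e := by exact_mod_cast hjm.symm
    rw [Real.log_div (by positivity) hn0.ne'] at h
    rw [sub_add_cancel, Real.log_div hn0.ne' hd0.ne', Real.log_div (by positivity) two_ne_zero]
    rw [hd']
    linarith

theorem sum_map_codeCost (pieces : List (List ℕ)) :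
    (pieces.map codeCost).sum * Real.log 2 =
      ((pieces.map fun p => (p.length : ℝ)).map Real.log).sum +
        ((pieces.map fun p => (p.sum : ℝ)).map Real.log).sum := by
  have h2 : Real.log 2 ≠ 0 := (Real.log_pos one_lt_two).ne'
  induction pieces with
  | nil => simp
  | cons p pieces ih =>
    simp only [List.map_cons, List.sum_cons, add_mul, ih, codeCost, Real.logb,
      div_mul_cancel₀ _ h2]
    ring

theorem sum_map_log_div {l : List ℝ} (hl : ∀ a ∈ l, 0 < a) {r : ℝ} (hr : 0 < r) :
    (l.map Real.log).sum = ((l.map (· / r)).map Real.log).sum + l.length * Real.log r := by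
  induction l with
  | nil => simp
  | cons a l ih =>
    simp only [List.map_cons, List.sum_cons, List.length_cons,
      ih fun b hb => hl b (List.mem_cons_of_mem _ hb), Real.log_div (hl a (by simp)).ne' hr.ne']
    push_cast
    ring

theorem sum_map_div (l : List ℝ) (r : ℝ) : (l.map (· / r)).sum = l.sum / r := by
  induction l with
  | nil => simp
  | cons a l ih => simp only [List.map_cons, List.sum_cons, ih, add_div]

theorem sum_map_length (pieces : List (List ℕ)) :
    (pieces.map fun p => (p.length : ℝ)).sum = (pieces.flatten.length : ℕ) := by
  induction pieces with
  | nil => simp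
  | cons p pieces ih => simp [ih]

theorem sum_map_sum (pieces : List (List ℕ)) :
    (pieces.map fun p => (p.sum : ℝ)).sum = (pieces.flatten.sum : ℕ) := by
  induction pieces with
  | nil => simp
  | cons p pieces ih =>
    rw [List.map_cons, List.sum_cons, ih, List.flatten_cons, List.sum_append, Nat.cast_add]

/-- The syndromes and checksums are cheap for every pattern of at least two deletions, up to
one symbol for every unmatched central symbol. -/
theorem codeCost_le {n d : ℕ} {x : List ℕ} {es : List Event} {pieces : List (List ℕ)}
    (hd : 2 ≤ d) (hdn : d ≤ n) (hx : x.Nodup) (hlen : x.length = n)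
    (hmem : ∀ a ∈ x, 1 ≤ a ∧ a ≤ n) (h : IsCodedPieces n x d es pieces) :
    (pieces.map codeCost).sum ≤ missingCount es * Real.logb 2 n + 3 * d * Real.logb 2 n
      - 2 * d * Real.logb 2 d - d * Real.logb 2 2 := by
  have hlog2 : 0 < Real.log 2 := Real.log_pos one_lt_two
  -- `e` bounds the number of central symbols from below: at least one is sent, and at least as many
  -- as are unmatched.
  obtain ⟨e, he⟩ : ∃ e, e = max (missingCount es) 1 := ⟨_, rfl⟩
  set m := missingCount es with hm
  have hnum := log_numeric_le hd hdn h.length_add he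
  have hjd : (pieces.length : ℝ) + m = d := by exact_mod_cast h.length_add
  have hd0 : (0 : ℝ) < d := by exact_mod_cast (by omega : 0 < d)
  have hen : pieces.flatten.length + e ≤ n := by
    have h1 := h.flatten_length
    have h2 := h.missing_le
    have h3 := h.one_le hd
    omega
  have henR : (pieces.flatten.length : ℝ) + e ≤ n := by exact_mod_cast hen
  have hμ : 0 < ((n : ℝ) - e + m) / d := by
    apply div_pos _ hd0
    have : (e : ℝ) < n + m := by exact_mod_cast (by omega : e < n + m)
    linarith
  have hdμ : (d : ℝ) * (((n : ℝ) - e + m) / d) = n - e + m := mul_div_cancel₀ _ hd0.ne'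
  have hpos1 : ∀ a ∈ pieces.map fun p => (p.length : ℝ), 0 < a := by
    intro a ha
    obtain ⟨p, hp, rfl⟩ := List.mem_map.1 ha
    exact_mod_cast List.length_pos_of_ne_nil (h.ne_nil p hp)
  have hsub : ∀ a ∈ pieces.flatten, a ∈ x := fun a ha => h.subperm.subset ha
  have hpos2 : ∀ a ∈ pieces.map fun p => (p.sum : ℝ), 0 < a := by
    intro a ha
    obtain ⟨p, hp, rfl⟩ := List.mem_map.1 ha
    obtain ⟨b, hb⟩ := List.exists_mem_of_ne_nil p (h.ne_nil p hp)
    have h1 := (hmem b (hsub b (List.mem_flatten.2 ⟨p, hp, hb⟩))).1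
    have h2 := List.le_sum_of_mem hb
    exact_mod_cast (by omega : 0 < p.sum)
  -- Padding by `m` ones makes `d` terms out of the `d - m` lengths at no cost in logarithms.
  have hsyn := sum_log_le hpos1 m hμ (by
    rw [List.length_map, hjd, hdμ, sum_map_length]; linarith)
  have hnodup : pieces.flatten.Nodup := by
    obtain ⟨l, hl, hl'⟩ := h.subperm
    exact hl.nodup_iff.1 (hx.sublist hl')
  have hsum := two_mul_sum_add_sq_le n pieces.flatten.toFinset (by
    intro a ha
    exact Finset.mem_Icc.2 (hmem a (hsub a (List.mem_toFinset.1 ha))))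
  rw [List.toFinset_card_of_nodup hnodup, List.sum_toFinset _ hnodup, List.map_id'] at hsum
  have hsumR : 2 * (pieces.flatten.sum : ℝ) + (pieces.flatten.length : ℝ) ^ 2 ≤
      pieces.flatten.length * (2 * n + 1) := by exact_mod_cast hsum
  have hr : 0 < ((n : ℝ) + e + 1) / 2 := by positivity
  -- With `q` the total length, `(n - e)(n + e + 1) - q (2 n + 1 - q) = (n - e - q)(n + 1 + e - q) ≥
  -- 0`. After this rescaling the checksums obey the same bound `n - e` as the lengths, so the same
  -- padded estimate applies.
  have hT : (pieces.flatten.sum : ℝ) / (((n : ℝ) + e + 1) / 2) ≤ n - e := by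
    rw [div_le_iff₀ hr]
    have hq : (0 : ℝ) ≤ pieces.flatten.length := Nat.cast_nonneg _
    have he0 : (0 : ℝ) ≤ e := Nat.cast_nonneg _
    nlinarith [mul_nonneg (sub_nonneg.2 henR)
      (show (0 : ℝ) ≤ n + 1 + e - pieces.flatten.length by linarith)]
  have hpos3 : ∀ a ∈ (pieces.map fun p => (p.sum : ℝ)).map (· / (((n : ℝ) + e + 1) / 2)),
      0 < a := by
    intro a ha
    obtain ⟨b, hb, rfl⟩ := List.mem_map.1 ha
    exact div_pos (hpos2 b hb) hr
  have hchk := sum_log_le hpos3 m hμ (by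
    rw [sum_map_div, sum_map_sum, List.length_map, List.length_map, hjd, hdμ]; linarith)
  have hdiv := sum_map_log_div hpos2 hr
  have htot := sum_map_codeCost pieces
  simp only [List.length_map, hjd] at hsyn hchk hdiv
  have hfin : (pieces.map codeCost).sum * Real.log 2 ≤
      m * Real.log n + 3 * d * Real.log n - 2 * d * Real.log d - d * Real.log 2 := by
    rw [htot]; linarith
  rw [← le_div_iff₀ hlog2] at hfin
  refine hfin.trans_eq ?_
  simp only [Real.logb]
  ring

end RankSync

namespace RankSync

/-! # Deletion patterns of a permutation -/

/-- The symbols of the word of a permutation, as a function of the position. -/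
def symbolEmbedding {n : ℕ} (σ : Equiv.Perm (Fin n)) : Fin n ↪ ℕ where
  toFun i := (σ i : ℕ) + 1
  inj' i j h := σ.injective (Fin.ext (by simpa using h))

theorem word_nodup {n : ℕ} (σ : Equiv.Perm (Fin n)) : (word σ).Nodup :=
  (List.nodup_finRange n).map (symbolEmbedding σ).injective

theorem length_word {n : ℕ} (σ : Equiv.Perm (Fin n)) : (word σ).length = n := by
  simp [word]

theorem mem_word {n : ℕ} (σ : Equiv.Perm (Fin n)) : ∀ a ∈ word σ, 1 ≤ a ∧ a ≤ n := by
  intro a ha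
  obtain ⟨i, -, rfl⟩ := List.mem_map.1 ha
  omega

theorem toFinset_word {n : ℕ} (σ : Equiv.Perm (Fin n)) :
    (word σ).toFinset = Finset.univ.map (symbolEmbedding σ) := by
  ext a
  simp only [word, List.mem_toFinset, List.mem_map, List.mem_finRange, true_and, Finset.mem_map,
    Finset.mem_univ]
  rfl

/-- Passes from deleted positions to deleted symbols, for which the subwords in the induction need
no reindexing. -/
theorem deletedWord_eq {n : ℕ} (σ : Equiv.Perm (Fin n)) (S : Finset (Fin n)) :
    deletedWord σ S = deleteSymbols (word σ) (S.map (symbolEmbedding σ)) := by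
  rw [deletedWord, deleteSymbols, word, List.filter_map]
  congr 1
  refine List.filter_congr fun i _ => ?_
  change decide (i ∉ S) = decide (symbolEmbedding σ i ∉ S.map (symbolEmbedding σ))
  simp only [Finset.mem_map']

theorem deletedWord_sublist {n : ℕ} (σ : Equiv.Perm (Fin n)) (S : Finset (Fin n)) :
    (deletedWord σ S).Sublist (word σ) := by
  rw [deletedWord_eq]; exact deleteSymbols_sublist _ _

theorem length_deletedWord {n : ℕ} (σ : Equiv.Perm (Fin n)) (S : Finset (Fin n)) :
    n - (deletedWord σ S).length = S.card := by
  have hS : S.card ≤ n := by simpa using Finset.card_le_univ S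
  rw [deletedWord_eq, length_deleteSymbols (word_nodup σ), length_word, Finset.card_map]
  · omega
  · rw [toFinset_word]; exact Finset.map_subset_map.2 (Finset.subset_univ S)

theorem limitedFeedback_word {n : ℕ} (σ : Equiv.Perm (Fin n)) (S : Finset (Fin n)) :
    limitedFeedback n S.card (word σ) (deletedWord σ S) =
      (some (word σ), transcript (word σ) (deletedWord σ S)) := by
  have := limitedFeedback_eq (word_nodup σ) (deletedWord_sublist σ S)
  rwa [length_word, length_deletedWord] at this

theorem feedbackBits_eq {n : ℕ} (σ : Equiv.Perm (Fin n)) (S : Finset (Fin n)) :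
    feedbackBits σ S = 3 * symbolCount (transcript (word σ) (deletedWord σ S)) := by
  rw [feedbackBits, limitedFeedback_word, sum_feedbackCost _ _ (word_nodup σ)
    (deletedWord_sublist σ S)]

theorem feedbackBits_le {n : ℕ} (σ : Equiv.Perm (Fin n)) (S : Finset (Fin n)) :
    feedbackBits σ S ≤ 3 * symbolCost (word σ) (S.map (symbolEmbedding σ)) := by
  rw [feedbackBits_eq, symbolCost, ← deletedWord_eq]
  push_cast
  have : (0 : ℝ) ≤ missingCount (transcript (word σ) (deletedWord σ S)) := Nat.cast_nonneg _
  linarith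

/-- The `m log n` from `codeCost_le` is absorbed by the second count of unmatched centres, leaving
one random quantity, whose mean is known. -/
theorem forwardBits_le {n d : ℕ} (hd : 2 ≤ d) (hdn : d ≤ n) (σ : Equiv.Perm (Fin n))
    {S : Finset (Fin n)} (hS : S ∈ patterns n d) :
    forwardBits σ S ≤ symbolCost (word σ) (S.map (symbolEmbedding σ)) * Real.logb 2 n +
      (3 * d * Real.logb 2 n - 2 * d * Real.logb 2 d - d * Real.logb 2 2) := by
  obtain ⟨pieces, h⟩ := exists_isCodedPieces n _ _ (word_nodup σ) (deletedWord_sublist σ S)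
  rw [length_word, length_deletedWord, (Finset.mem_powersetCard.1 hS).2] at h
  have h1 := codeCost_le hd hdn (word_nodup σ) (length_word σ) (mem_word σ) h
  rw [forwardBits, limitedFeedback_word, h.cost, symbolCost, ← deletedWord_eq]
  push_cast
  linarith

theorem sum_word {n : ℕ} (σ : Equiv.Perm (Fin n)) : 2 * (word σ).sum = n * (n + 1) := by
  have h1 : (word σ).sum = ∑ i : Fin n, ((σ i : ℕ) + 1) := by
    rw [word, Fin.sum_univ_def]
  rw [h1, Equiv.sum_comp σ fun i : Fin n => (i : ℕ) + 1, Fin.sum_univ_eq_sum_range (· + 1),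
    Finset.sum_add_distrib, mul_add, mul_comm 2, Finset.sum_range_id_mul_two]
  cases n <;> simp
  ring

theorem forwardBits_single {n : ℕ} (hn : 1 ≤ n) (σ : Equiv.Perm (Fin n)) {S : Finset (Fin n)}
    (hS : S ∈ patterns n 1) :
    forwardBits σ S = 3 * Real.logb 2 n - Real.logb 2 2 + Real.logb 2 (1 + 1 / (n : ℝ)) := by
  have hn0 : (0 : ℝ) < n := by exact_mod_cast hn
  have hlen := length_deletedWord σ S
  rw [(Finset.mem_powersetCard.1 hS).2] at hlen
  have hw := length_word σ
  have hsum : ((word σ).sum : ℝ) = n * n * (1 + 1 / n) / 2 := by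
    have : (2 : ℝ) * (word σ).sum = n * (n + 1) := by exact_mod_cast sum_word σ
    field_simp
    linarith
  rw [forwardBits, limitedFeedback_word, transcript_single (by omega)]
  simp only [List.map_cons, List.map_nil, List.sum_cons, List.sum_nil, forwardCost,
    length_inversionVector, checksum, hw, Nat.sub_add_cancel hn, hsum]
  rw [Real.logb_div (by positivity) two_ne_zero, Real.logb_mul (by positivity) (by positivity),
    Real.logb_mul (by positivity) (by positivity)]
  ring

theorem card_patterns (n d : ℕ) : (patterns n d).card = n.choose d := by
  simp [patterns]

theorem patterns_nonempty {n d : ℕ} (hdn : d ≤ n) : (patterns n d).Nonempty := by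
  rw [← Finset.card_pos, card_patterns]; exact Nat.choose_pos hdn

/-- The expected number of central symbols, where unmatched ones count twice. -/
theorem expect_symbolCost_le {n d : ℕ} (hd : 1 ≤ d) (hdn : d ≤ n) (σ : Equiv.Perm (Fin n)) :
    Finset.expect (patterns n d)
      (fun S => (symbolCost (word σ) (S.map (symbolEmbedding σ)) : ℝ)) ≤ 2 * (d - 1) := by
  have h := sum_symbolCost_sub_nonpos (word σ) (word_nodup σ) d
  rw [toFinset_word, Finset.powersetCard_map, Finset.sum_map] at h
  change ∑ S ∈ patterns n d, ((symbolCost (word σ) (S.map (symbolEmbedding σ)) : ℝ) -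
    symbolBound (S.map (symbolEmbedding σ)).card) ≤ 0 at h
  have hb : ∀ S ∈ patterns n d,
      symbolBound (S.map (symbolEmbedding σ)).card = 2 * ((d : ℝ) - 1) := by
    intro S hS
    rw [Finset.card_map, (Finset.mem_powersetCard.1 hS).2, symbolBound, if_neg (by omega)]
  rw [Finset.sum_sub_distrib, Finset.sum_congr rfl hb, Finset.sum_const, nsmul_eq_mul] at h
  rw [Finset.expect_eq_sum_div_card, div_le_iff₀
    (by exact_mod_cast Finset.card_pos.2 (patterns_nonempty hdn))]
  linarith

end RankSync

theorem theorem1 (n d : ℕ) (hd : 1 ≤ d) (hdn : d ≤ n) (σ : Equiv.Perm (Fin n)) :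
    (∀ S ∈ RankSync.patterns n d,
      (RankSync.limitedFeedback n d (RankSync.word σ) (RankSync.deletedWord σ S)).1 =
        some (RankSync.word σ)) ∧
    (2 ≤ d →
      Finset.expect (RankSync.patterns n d) (fun S => RankSync.forwardBits σ S) ≤
        (5 * (d : ℝ) - 2) * Real.logb 2 n - 2 * (d : ℝ) * Real.logb 2 d
          - (d : ℝ) * Real.logb 2 2) ∧
    (d = 1 →
      Finset.expect (RankSync.patterns n d) (fun S => RankSync.forwardBits σ S) =
        3 * Real.logb 2 n - Real.logb 2 2 + Real.logb 2 (1 + 1 / (n : ℝ))) ∧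
    Finset.expect (RankSync.patterns n d) (fun S => RankSync.feedbackBits σ S) ≤
      6 * ((d : ℝ) - 1) := by
  have hexp := RankSync.expect_symbolCost_le hd hdn σ
  have hne := RankSync.patterns_nonempty hdn
  have hn1 : (1 : ℝ) ≤ n := by exact_mod_cast hd.trans hdn
  refine ⟨fun S hS => ?_, fun hd2 => ?_, ?_, ?_⟩
  · have h := RankSync.limitedFeedback_word σ S
    rw [(Finset.mem_powersetCard.1 hS).2] at h
    rw [h]
  · refine (Finset.expect_le_expect fun S hS =>
      RankSync.forwardBits_le hd2 hdn σ hS).trans ?_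
    rw [Finset.expect_add_distrib, Finset.expect_const hne, ← Finset.expect_mul]
    have := mul_le_mul_of_nonneg_right hexp (Real.logb_nonneg one_lt_two hn1)
    linarith
  · rintro rfl
    rw [Finset.expect_congr rfl fun S hS => RankSync.forwardBits_single hdn σ hS,
      Finset.expect_const hne]
  · refine (Finset.expect_le_expect fun S _ => RankSync.feedbackBits_le σ S).trans ?_
    rw [← Finset.mul_expect]
    linarith
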